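/- A \emph{non-commutative probability space} is a unital $\mathbb{C}$-algebra $\mathcal{A}$ with a linear functional $\phi:\mathcal{A}\to\mathbb{C}$ such that $\phi(1)=1$. The \emph{law} of $a\in\mathcal{A}$ is the linear functional $\mu_a:\mathbb{C}[X]\to\mathbb{C}$, $\mu_a(X^n)=\phi(a^n)$. Let $$\Sigma=\{\mu:\mathbb{C}[X]\to\mathbb{C}\ \text{linear},\ \mu(1)=1\},\qquad \Sigma_1^\times=\{\mu\in\Sigma:\ \mu(X)=1\},$$ and write $m_n(\mu)=\mu(X^n)$. Elements $a,b\in\mathcal{A}$ are \emph{free} if $\phi(x_1\cdots x_n)=0$ for every $n\ge 1$ whenever $\phi(x_j)=0$ for all $j$ and the $x_j$ belong alternately to the unital subalgebras generated by $a$ and by $b$. For $\mu,\nu\in\Sigma$, the additive free convolution $\mu\boxplus\nu$ (resp. the multiplicative free convolution $\mu\boxtimes\nu$) is the law of $a+b$ (resp. of $ab$), where $a,b$ are free elements of a non-commutative probability space with $\mu_a=\mu$, $\mu_b=\nu$. For $\mu\in\Sigma$ let $G_\mu(z)=\sum_{n\ge0}m_n(\mu)z^{-(n+1)}$, let $G_\mu^{-1}(z)=\frac1z+\sum_{n\ge0}\alpha_nz^n$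 be its compositional inverse, and put $R(\mu)(z)=z\left(G_\mu^{-1}(z)-\frac1z\right)\in z\mathbb{C}[[z]]$. For $\mu\in\Sigma_1^\times$ let $M_\mu(z)=\sum_{n\ge1}m_n(\mu)z^n$, let $M_\mu^{-1}$ be its compositional inverse, and put $S(\mu)(z)=\frac{1+z}{z}M_\mu^{-1}(z)\in\Lambda(\mathbb{C}):=1+z\mathbb{C}[[z]]$. Let $z\frac{d}{dz}\log:\Lambda(\mathbb{C})\to z\mathbb{C}[[z]]$ be the map $f\mapsto z\,(\log f)'$. \textbf{Proposition.} The operations $\boxplus$ and $\boxtimes$ are well defined: for all $\mu,\nu\in\Sigma$ such free $a,b$ exist, and the laws of $a+b$ and of $ab$ depend only on $\mu$ and $\nu$. The maps $R:\Sigma\to z\mathbb{C}[[z]]$, $S:\Sigma_1^\times\to\Lambda(\mathbb{C})$ and $z\frac{d}{dz}\log:\Lambda(\mathbb{C})\to z\mathbb{C}[[z]]$ are bijective. $(\Sigma_1^\times,\boxtimes)$ and $(\Sigma,\boxplus)$ are abelian groups, and the map $$\operatorname{LOG}:=R^{-1}\circ\left(z\tfrac{d}{dz}\log\right)\circ S:\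 (\Sigma_1^\times,\boxtimes)\longrightarrow(\Sigma,\boxplus)$$ is a group isomorphism, with inverse $\operatorname{EXP}:=S^{-1}\circ\left(z\tfrac{d}{dz}\log\right)^{-1}\circ R$. -/

import Mathlib

open scoped PowerSeries Polynomial

universe u

noncomputable section

namespace FreeProb

/-! ### Laws, non-commutative probability spaces, freeness -/

/-- The set `Σ` of (algebraic) laws: linear functionals on `ℂ[X]` sending `1` to `1`. -/
structure Law where
  toLin : ℂ[X] →ₗ[ℂ] ℂ
  map_one : toLin 1 = 1

/-- The `n`-th moment `μ(Xⁿ)`. -/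
def Law.moment (μ : Law) (n : ℕ) : ℂ := μ.toLin (Polynomial.X ^ n)

/-- The set `Σ₁ˣ` of laws of mean one. -/
abbrev MeanOneLaw : Type := {μ : Law // μ.toLin Polynomial.X = 1}

/-- Evaluation of polynomials at `1`, as a law. -/
def Law.evalOne : Law := ⟨Polynomial.leval 1, by simp⟩

instance : Nonempty Law := ⟨Law.evalOne⟩

instance : Nonempty MeanOneLaw := ⟨⟨Law.evalOne, by simp [Law.evalOne]⟩⟩

/-- A non-commutative probability space structure on a unital complex algebra `A`:
a linear functional `φ` with `φ 1 = 1`. -/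
structure NCProbSpace (A : Type*) [Ring A] [Algebra ℂ A] where
  φ : A →ₗ[ℂ] ℂ
  map_one : φ 1 = 1

section
variable {A : Type*} [Ring A] [Algebra ℂ A]

/-- The law of a random variable `a`: the functional `p ↦ φ (p(a))`, so that `Xⁿ ↦ φ(aⁿ)`. -/
def NCProbSpace.law (P : NCProbSpace A) (a : A) : Law where
  toLin := P.φ ∘ₗ (Polynomial.aeval a).toLinearMap
  map_one := by simp [P.map_one]

/-- Freeness of a family of unital subalgebras: `φ(x₀ x₁ ⋯ xₙ) = 0` whenever the `xⱼ` are
centred and consecutive factors come from subalgebras with distinct indices. -/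
def NCProbSpace.IsFree (P : NCProbSpace A) {I : Type*} (B : I → Subalgebra ℂ A) : Prop :=
  ∀ (n : ℕ) (i : Fin (n + 1) → I) (x : Fin (n + 1) → A),
    (∀ j : Fin n, i j.castSucc ≠ i j.succ) → (∀ j, x j ∈ B (i j)) → (∀ j, P.φ (x j) = 0) →
      P.φ (List.ofFn x).prod = 0

/-- Freeness of a pair of random variables. -/
def NCProbSpace.IsFreePair (P : NCProbSpace A) (a b : A) : Prop :=
  P.IsFree (fun k : Fin 2 => Algebra.adjoin ℂ {(![a, b] : Fin 2 → A) k})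

end

/-! ### Free convolutions -/

/-- `ρ` is the law of `a + b` for some free pair `a, b` with laws `μ, ν`. -/
def IsFreeAddConv (μ ν ρ : Law) : Prop :=
  ∃ (A : Type u) (_ : Ring A) (_ : Algebra ℂ A) (P : NCProbSpace A) (a b : A),
    P.IsFreePair a b ∧ P.law a = μ ∧ P.law b = ν ∧ P.law (a + b) = ρ

/-- `ρ` is the law of `a * b` for some free pair `a, b` with laws `μ, ν`. -/
def IsFreeMulConv (μ ν ρ : Law) : Prop :=
  ∃ (A : Type u) (_ : Ring A) (_ : Algebra ℂ A) (P : NCProbSpace A) (a b : A),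
    P.IsFreePair a b ∧ P.law a = μ ∧ P.law b = ν ∧ P.law (a * b) = ρ

/-- The additive free convolution `μ ⊞ ν`. -/
def freeAddConv (μ ν : Law) : Law := Classical.epsilon (IsFreeAddConv.{0} μ ν)

/-- The multiplicative free convolution `μ ⊠ ν`. -/
def freeMulConv (μ ν : Law) : Law := Classical.epsilon (IsFreeMulConv.{0} μ ν)

/-! ### Transforms -/

/-- `z ℂ⟦z⟧`. -/
abbrev MaxSeries : Type := {f : ℂ⟦X⟧ // PowerSeries.constantCoeff f = 0}

/-- `Λ(ℂ) = 1 + z ℂ⟦z⟧`. -/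
abbrev UnitalSeries : Type := {f : ℂ⟦X⟧ // PowerSeries.constantCoeff f = 1}

instance : Nonempty UnitalSeries := ⟨⟨1, by simp⟩⟩

/-- The Cauchy transform `G(z) = ∑ mₙ z^{-(n+1)}`, written as a power series in `w = 1/z`:
`∑ mₙ w^{n+1}`. -/
def cauchySeries (μ : Law) : ℂ⟦X⟧ := PowerSeries.X * PowerSeries.mk μ.moment

lemma isUnit_coeff_one_cauchySeries (μ : Law) :
    IsUnit (PowerSeries.coeff 1 (cauchySeries μ)) := by
  have h : PowerSeries.coeff (0 + 1) (cauchySeries μ) = 1 := by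
    rw [cauchySeries, PowerSeries.coeff_succ_X_mul]
    simp [Law.moment, μ.map_one]
  rw [zero_add] at h
  simp [h]

/-- The compositional inverse `G⁻¹(z) = 1/z + ∑ αₙ zⁿ` of the Cauchy transform. As `G` is the
series `cauchySeries μ` at `1/z`, `G⁻¹` is the reciprocal of the compositional inverse of
`cauchySeries μ`. -/
def cauchyInv (μ : Law) : LaurentSeries ℂ :=
  (((cauchySeries μ).substInvOfIsUnit (isUnit_coeff_one_cauchySeries μ) : ℂ⟦X⟧) :
    LaurentSeries ℂ)⁻¹

/-- The transform `ℛ(z) = G⁻¹(z) - 1/z`, a power series in `z`. -/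
def calRTransform (μ : Law) : ℂ⟦X⟧ :=
  PowerSeries.mk fun n => (cauchyInv μ - HahnSeries.single (-1 : ℤ) (1 : ℂ)).coeff (n : ℤ)

/-- The (modified) `R`-transform `R(z) = z ℛ(z)`. -/
def rTransform (μ : Law) : MaxSeries := ⟨PowerSeries.X * calRTransform μ, by simp⟩

/-- The moment series `M(z) = ∑_{n ≥ 1} mₙ zⁿ`. -/
def momentSeries (μ : Law) : ℂ⟦X⟧ := PowerSeries.mk fun n => if n = 0 then 0 else μ.moment n

lemma coeff_one_momentSeries (μ : Law) :
    PowerSeries.coeff 1 (momentSeries μ) = μ.toLin Polynomial.X := by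
  simp [momentSeries, Law.moment]

/-- The `S`-transform `S(z) = ((1 + z) / z) M⁻¹(z)` of a law of nonzero mean; the quotient
`M⁻¹(z) / z` is formed by shifting coefficients (`M⁻¹` has no constant term). -/
def sSeries (μ : Law) (h : μ.toLin Polynomial.X ≠ 0) : ℂ⟦X⟧ :=
  (1 + PowerSeries.X) * PowerSeries.mk fun n => PowerSeries.coeff (n + 1)
    ((momentSeries μ).substInvOfIsUnit (by rw [coeff_one_momentSeries]; exact h.isUnit))

/-- The `S`-transform on laws of mean one, with values in `Λ(ℂ)`. -/
def sTransform (μ : MeanOneLaw) : UnitalSeries :=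
  ⟨sSeries μ.1 (by rw [μ.2]; exact one_ne_zero), by
    simp [sSeries, PowerSeries.coeff_one_substInvOfIsUnit, coeff_one_momentSeries, μ.2]⟩

/-- The map `z d/dz log : Λ(ℂ) → z ℂ⟦z⟧`. -/
def zDLog (f : UnitalSeries) : MaxSeries :=
  ⟨PowerSeries.X * PowerSeries.derivative ℂ (PowerSeries.logOf f.1), by simp⟩

/-- `LOG = R⁻¹ ∘ (z d/dz log) ∘ S`. -/
def LOG : MeanOneLaw → Law := Function.invFun rTransform ∘ zDLog ∘ sTransform

/-- `EXP = S⁻¹ ∘ (z d/dz log)⁻¹ ∘ R`. -/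
def EXP : Law → MeanOneLaw := Function.invFun sTransform ∘ Function.invFun zDLog ∘ rTransform

end FreeProb

end

noncomputable section

namespace FreeProb

/-! ### Laws and moments -/

/-! Everything reduces to linearisation: `rTransform` is a bijection turning ⊞ into addition,
`sTransform` is a bijection turning ⊠ into multiplication, and `zDLog` is a bijection from products
to sums. The group structures are then transported along these bijections, and `LOG` and `EXP` are
the resulting isomorphisms.

Linearisation comes from operator models on the full Fock space with vacuum Ω, creation operators lᵢ
and annihilation operators lᵢ*. The vacuum law of lᵢ + f(lᵢ*) has ℛ = f, and that of (1 + lᵢ) f(lᵢ*)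
has S = 1/f when f(0) = 1. The reason is that ω(z) = ∑ zᵏ CᵏΩ with C = lᵢ satisfies lᵢ* ω(z) = z
ω(z); up to a multiple of Ω the model acts on ω(z) as a scalar series, and the resolvent identity
inverts the moment series (`subst_moments_of_add`, `subst_moments_of_mul`). For two letters the same
argument runs with C = lᵢ + lⱼ for the sum and 1 + C = (1 + lᵢ)(1 + lⱼ) for the product, giving f +
g and 1/(fg).

Models on distinct letters are free (`Fock.isFree_leading`). Since a law is determined by its
transform, the models realise all laws, so free pairs exist. Conversely freeness determines the
joint law (`NCProbSpace.IsFree.joint_law_eq`), so the convolutions do not depend on the pair chosen.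
-/

lemma Law.moment_zero (μ : Law) : μ.moment 0 = 1 := by simp [Law.moment, μ.map_one]

lemma Law.moment_one (μ : Law) : μ.moment 1 = μ.toLin Polynomial.X := by simp [Law.moment]

lemma Law.ext_moment {μ ν : Law} (h : ∀ n, μ.moment n = ν.moment n) : μ = ν := by
  obtain ⟨f, hf⟩ := μ
  obtain ⟨g, hg⟩ := ν
  have : f = g := by
    ext n
    simpa [Law.moment, Polynomial.X_pow_eq_monomial] using h n
  subst this
  rfl

/-! ### Compositional inverses -/

lemma hasSubst_of_constantCoeff {w : ℂ⟦X⟧} (hw : PowerSeries.constantCoeff w = 0) :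
    PowerSeries.HasSubst w := PowerSeries.HasSubst.of_constantCoeff_zero' hw

lemma subst_one_eq_one (w : ℂ⟦X⟧) : (1 : ℂ⟦X⟧).subst w = (1 : ℂ⟦X⟧) := by
  rw [← map_one PowerSeries.C, PowerSeries.subst_C]
  exact map_one PowerSeries.C

/-- A right compositional inverse is the compositional inverse. -/
lemma substInvOfIsUnit_eq_of_subst {P w : ℂ⟦X⟧} (hP : PowerSeries.constantCoeff P = 0)
    (hP' : IsUnit (PowerSeries.coeff 1 P)) (hw : PowerSeries.constantCoeff w = 0)
    (h : P.subst w = PowerSeries.X) : P.substInvOfIsUnit hP' = w := by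
  have h1 := PowerSeries.subst_comp_subst_apply (hasSubst_of_constantCoeff hP)
    (hasSubst_of_constantCoeff hw) (P.substInvOfIsUnit hP')
  rw [PowerSeries.subst_substInvOfIsUnit_left _ hP hP', h, PowerSeries.X_subst,
    PowerSeries.subst_X (hasSubst_of_constantCoeff hw)] at h1
  exact h1.symm

/-- Two series with the same compositional inverse are equal. -/
lemma eq_of_substInvOfIsUnit_eq {P Q : ℂ⟦X⟧} (hP : PowerSeries.constantCoeff P = 0)
    (hQ : PowerSeries.constantCoeff Q = 0)
    (hP' : IsUnit (PowerSeries.coeff 1 P)) (hQ' : IsUnit (PowerSeries.coeff 1 Q))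
    (h : P.substInvOfIsUnit hP' = Q.substInvOfIsUnit hQ') : P = Q := by
  have key : ∀ (P : ℂ⟦X⟧) (hP : PowerSeries.constantCoeff P = 0)
      (hP' : IsUnit (PowerSeries.coeff 1 P)) (I : IsUnit (PowerSeries.coeff 1 (P.substInvOfIsUnit hP'))),
      (P.substInvOfIsUnit hP').substInvOfIsUnit I = P := fun P hP hP' I =>
    substInvOfIsUnit_eq_of_subst (by simp) I hP (PowerSeries.subst_substInvOfIsUnit_left _ hP hP')
  have I : IsUnit (PowerSeries.coeff 1 (P.substInvOfIsUnit hP')) := by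
    rw [PowerSeries.coeff_one_substInvOfIsUnit _ hP']
    exact Units.isUnit _
  have J : IsUnit (PowerSeries.coeff 1 (Q.substInvOfIsUnit hQ')) := h ▸ I
  rw [← key P hP hP' I, ← key Q hQ hQ' J]
  congr 1

/-- A backward recursion for a sequence of series computes a composition. -/
lemma subst_mk_of_recursion {w : ℂ⟦X⟧} (hw : PowerSeries.constantCoeff w = 0) (m : ℕ → ℂ)
    (u : ℕ → ℂ⟦X⟧) (h : ∀ n, u n = PowerSeries.C (m n) + w * u (n + 1)) :
    (PowerSeries.mk m).subst w = u 0 := by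
  have hs := hasSubst_of_constantCoeff hw
  -- Unrolling the recursion `N` times leaves a remainder divisible by `w ^ N`; as `w` has no
  -- constant term, no coefficient of the difference survives.
  have key : ∀ N n, ∃ r : ℂ⟦X⟧,
      (PowerSeries.mk fun k => m (k + n)).subst w - u n = w ^ N * r := by
    intro N
    induction N with
    | zero => exact fun n => ⟨_, (one_mul _).symm⟩
    | succ N ih =>
      intro n
      obtain ⟨r, hr⟩ := ih (n + 1)
      refine ⟨r, ?_⟩
      have e : (PowerSeries.mk fun k => m (k + n)) =
          PowerSeries.C (m n) + PowerSeries.X * PowerSeries.mk fun k => m (k + (n + 1)) := by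
        ext k
        cases k with
        | zero => simp
        | succ k => simp [PowerSeries.coeff_succ_X_mul, add_assoc, add_comm 1 n]
      rw [e, PowerSeries.subst_add hs, PowerSeries.subst_mul hs, PowerSeries.subst_X hs,
        PowerSeries.subst_C, h n, pow_succ', mul_assoc, ← hr]
      change PowerSeries.C (m n) + _ - _ = _
      ring
  rw [← sub_eq_zero]
  ext k
  obtain ⟨r, hr⟩ := key (k + 1) 0
  simp only [add_zero] at hr
  obtain ⟨v, rfl⟩ := PowerSeries.X_dvd_iff.2 hw
  rw [hr, mul_pow, mul_assoc, PowerSeries.coeff_X_pow_mul', if_neg (by omega), map_zero]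

/-! ### The `R`-transform -/

lemma constantCoeff_cauchySeries (μ : Law) : PowerSeries.constantCoeff (cauchySeries μ) = 0 := by
  simp [cauchySeries]

lemma cauchySeries_injective : Function.Injective cauchySeries := fun μ ν h =>
  Law.ext_moment fun n => by
    simpa [cauchySeries, PowerSeries.coeff_succ_X_mul] using
      congrArg (PowerSeries.coeff (n + 1)) h

/-- The first hypothesis says 1/w = 1/z + f, and the second that w inverts the Cauchy series, so 1/w
is G⁻¹. This avoids Laurent series in all later arguments. -/
lemma calRTransform_eq_of_subst {μ : Law} {f w : ℂ⟦X⟧}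
    (hw : w * (1 + PowerSeries.X * f) = PowerSeries.X)
    (h : (cauchySeries μ).subst w = PowerSeries.X) : calRTransform μ = f := by
  have hw0 : PowerSeries.constantCoeff w = 0 := by
    simpa using congrArg PowerSeries.constantCoeff hw
  have e := substInvOfIsUnit_eq_of_subst (constantCoeff_cauchySeries μ)
    (isUnit_coeff_one_cauchySeries μ) hw0 h
  have hwL : (w : LaurentSeries ℂ) * (1 + HahnSeries.single (1 : ℤ) (1 : ℂ) * (f : LaurentSeries ℂ))
      = HahnSeries.single (1 : ℤ) (1 : ℂ) := by
    have := congrArg (fun g : ℂ⟦X⟧ => (g : LaurentSeries ℂ)) hw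
    simpa using this
  have hs : (HahnSeries.single (-1 : ℤ) (1 : ℂ)) * HahnSeries.single (1 : ℤ) (1 : ℂ)
      = (1 : LaurentSeries ℂ) := by simp
  have hinv : cauchyInv μ = HahnSeries.single (-1 : ℤ) (1 : ℂ) + (f : LaurentSeries ℂ) := by
    rw [cauchyInv, e]
    refine inv_eq_of_mul_eq_one_right ?_
    linear_combination (HahnSeries.single (-1 : ℤ) (1 : ℂ)) * hwL + (1 - (w : LaurentSeries ℂ) * f) * hs
  ext n
  rw [calRTransform, hinv, PowerSeries.coeff_mk, add_sub_cancel_left]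
  simp

lemma substInv_cauchySeries_mul (μ : Law) :
    (cauchySeries μ).substInvOfIsUnit (isUnit_coeff_one_cauchySeries μ) *
      (1 + PowerSeries.X * calRTransform μ) = PowerSeries.X := by
  set w := (cauchySeries μ).substInvOfIsUnit (isUnit_coeff_one_cauchySeries μ) with hw
  have hc : PowerSeries.coeff 1 (cauchySeries μ) = 1 := by
    simp [cauchySeries, μ.moment_zero]
  have hw1 : PowerSeries.coeff 1 w = 1 := by
    rw [hw, PowerSeries.coeff_one_substInvOfIsUnit _ (isUnit_coeff_one_cauchySeries μ)]
    simp [hc]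
  obtain ⟨v, hv⟩ := PowerSeries.X_dvd_iff.2
    (show PowerSeries.constantCoeff w = 0 by simp [hw])
  have hv0 : PowerSeries.constantCoeff v = 1 := by
    rw [hv] at hw1
    simpa using (PowerSeries.coeff_succ_X_mul 0 v).symm.trans hw1
  have hvv : v * v⁻¹ = 1 := PowerSeries.mul_inv_cancel _ (by simp [hv0])
  obtain ⟨f, hf⟩ := PowerSeries.X_dvd_iff.2
    (show PowerSeries.constantCoeff (v⁻¹ - 1) = 0 by simp [hv0])
  have hwf : w * (1 + PowerSeries.X * f) = PowerSeries.X := by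
    rw [← hf, hv]
    linear_combination PowerSeries.X * hvv
  rw [calRTransform_eq_of_subst hwf
    (PowerSeries.subst_substInvOfIsUnit_right _ (constantCoeff_cauchySeries μ) _), hwf]

lemma calRTransform_injective : Function.Injective calRTransform := by
  intro μ ν h
  apply cauchySeries_injective
  refine eq_of_substInvOfIsUnit_eq (constantCoeff_cauchySeries μ) (constantCoeff_cauchySeries ν)
    (isUnit_coeff_one_cauchySeries μ) (isUnit_coeff_one_cauchySeries ν) ?_
  have h1 := substInv_cauchySeries_mul μ
  rw [h] at h1
  refine mul_right_cancel₀ (fun h0 => ?_) (h1.trans (substInv_cauchySeries_mul ν).symm)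
  simpa using congrArg PowerSeries.constantCoeff h0

/-! ### The `S`-transform -/

lemma constantCoeff_momentSeries (μ : Law) : PowerSeries.constantCoeff (momentSeries μ) = 0 := by
  simp [momentSeries]

lemma mk_moment_eq (μ : Law) : PowerSeries.mk μ.moment = 1 + momentSeries μ := by
  ext n
  by_cases h : n = 0
  · simp [h, momentSeries, μ.moment_zero]
  · simp [h, momentSeries, PowerSeries.coeff_one]

lemma momentSeries_injective : Function.Injective momentSeries := fun μ ν h =>
  Law.ext_moment fun n => by
    simpa using congrArg (PowerSeries.coeff n)
      ((mk_moment_eq μ).trans ((congrArg (1 + ·) h).trans (mk_moment_eq ν).symm))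

lemma isUnit_coeff_one_momentSeries {μ : Law} (h : μ.toLin Polynomial.X ≠ 0) :
    IsUnit (PowerSeries.coeff 1 (momentSeries μ)) := by
  rw [coeff_one_momentSeries]
  exact h.isUnit

lemma X_mul_sSeries (μ : Law) (h : μ.toLin Polynomial.X ≠ 0) :
    PowerSeries.X * sSeries μ h = (1 + PowerSeries.X) *
      (momentSeries μ).substInvOfIsUnit (isUnit_coeff_one_momentSeries h) := by
  rw [sSeries, mul_left_comm]
  congr 1
  ext n
  cases n with
  | zero => simp
  | succ n => rw [PowerSeries.coeff_succ_X_mul, PowerSeries.coeff_mk]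

lemma sSeries_eq_of_subst {μ : Law} (h : μ.toLin Polynomial.X ≠ 0) {s w : ℂ⟦X⟧}
    (hw : PowerSeries.X * s = (1 + PowerSeries.X) * w)
    (hs : (momentSeries μ).subst w = PowerSeries.X) : sSeries μ h = s := by
  have hw0 : PowerSeries.constantCoeff w = 0 := by
    simpa using (congrArg PowerSeries.constantCoeff hw).symm
  apply mul_left_cancel₀ (PowerSeries.X_ne_zero (R := ℂ))
  rw [X_mul_sSeries, hw, substInvOfIsUnit_eq_of_subst (constantCoeff_momentSeries μ) _ hw0 hs]

lemma sTransform_injective : Function.Injective sTransform := by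
  intro μ ν h
  apply Subtype.ext
  apply momentSeries_injective
  have hμ : μ.1.toLin Polynomial.X ≠ 0 := by rw [μ.2]; exact one_ne_zero
  have hν : ν.1.toLin Polynomial.X ≠ 0 := by rw [ν.2]; exact one_ne_zero
  refine eq_of_substInvOfIsUnit_eq (constantCoeff_momentSeries _) (constantCoeff_momentSeries _)
    (isUnit_coeff_one_momentSeries hμ) (isUnit_coeff_one_momentSeries hν) ?_
  have hs : sSeries μ.1 hμ = sSeries ν.1 hν := congrArg Subtype.val h
  refine mul_left_cancel₀ (fun h0 => ?_)
    ((X_mul_sSeries _ hμ).symm.trans ((congrArg _ hs).trans (X_mul_sSeries _ hν)))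
  simpa using congrArg PowerSeries.constantCoeff h0

/-! ### The map `z d/dz log` -/

lemma mul_derivative_logOf {f : ℂ⟦X⟧} (hf : PowerSeries.constantCoeff f = 1) :
    f * PowerSeries.derivative ℂ (PowerSeries.logOf f) = PowerSeries.derivative ℂ f := by
  have hs := hasSubst_of_constantCoeff
    (show PowerSeries.constantCoeff (f - 1) = 0 by simp [hf])
  have hgeom : (1 + PowerSeries.X) * PowerSeries.derivative ℂ (PowerSeries.log ℂ) = 1 := by
    rw [PowerSeries.deriv_log, add_mul, one_mul]
    ext n
    cases n with
    | zero => simp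
    | succ n => simp [PowerSeries.coeff_succ_X_mul, pow_succ, PowerSeries.coeff_one]
  have h := congrArg (PowerSeries.subst (f - 1)) hgeom
  rw [PowerSeries.subst_mul hs, PowerSeries.subst_add hs, PowerSeries.subst_X hs,
    subst_one_eq_one] at h
  rw [PowerSeries.logOf_eq, PowerSeries.derivative_subst hs, map_sub,
    PowerSeries.derivative_one]
  linear_combination PowerSeries.derivative ℂ f * h

/-- The logarithm is eliminated: this equation determines `zDLog f`, and the later arguments about
`zDLog` use only it. -/
lemma mul_zDLog (f : UnitalSeries) :
    f.1 * (zDLog f).1 = PowerSeries.X * PowerSeries.derivative ℂ f.1 := by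
  rw [zDLog, mul_left_comm, mul_derivative_logOf f.2]

lemma UnitalSeries.ne_zero (f : UnitalSeries) : f.1 ≠ 0 := fun h => by
  simpa [h] using f.2

/-- Multiplication on `Λ(ℂ)`. -/
def UnitalSeries.mul (f g : UnitalSeries) : UnitalSeries := ⟨f.1 * g.1, by simp [f.2, g.2]⟩

lemma zDLog_mul (f g : UnitalSeries) :
    (zDLog (f.mul g)).1 = (zDLog f).1 + (zDLog g).1 := by
  apply mul_left_cancel₀ (f.mul g).ne_zero
  rw [mul_zDLog]
  simp only [UnitalSeries.mul, Derivation.leibniz, smul_eq_mul]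
  linear_combination -g.1 * mul_zDLog f - f.1 * mul_zDLog g

lemma zDLog_injective : Function.Injective zDLog := by
  intro f g h
  have hX : f.1 * PowerSeries.derivative ℂ g.1 = g.1 * PowerSeries.derivative ℂ f.1 := by
    apply mul_left_cancel₀ (PowerSeries.X_ne_zero (R := ℂ))
    have hf := mul_zDLog f
    rw [h] at hf
    linear_combination g.1 * hf - f.1 * mul_zDLog g
  have hg : g.1 * g.1⁻¹ = 1 := PowerSeries.mul_inv_cancel _ (by simp [g.2])
  -- Equal logarithmic derivatives make the quotient f/g have zero derivative, and its constant term
  -- is 1.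
  have hq : f.1 * g.1⁻¹ = 1 := by
    apply PowerSeries.derivative.ext
    · rw [Derivation.leibniz, PowerSeries.derivative_inv', PowerSeries.derivative_one]
      simp only [smul_eq_mul]
      linear_combination -(g.1⁻¹) ^ 2 * hX - PowerSeries.derivative ℂ f.1 * g.1⁻¹ * hg
    · simp [f.2, g.2]
  apply Subtype.ext
  linear_combination g.1 * hq - f.1 * hg

lemma zDLog_surjective : Function.Surjective zDLog := by
  intro h
  -- `F` is the antiderivative of h(z)/z, and exp F is the preimage. At `n = 0` the junk value of
  -- division by zero gives the required constant term 0.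
  let F : ℂ⟦X⟧ := PowerSeries.mk fun n => PowerSeries.coeff n h.1 / n
  have hF0 : PowerSeries.constantCoeff F = 0 := by simp [F]
  have hF : PowerSeries.X * PowerSeries.derivative ℂ F = h.1 := by
    ext n
    cases n with
    | zero => simp [h.2]
    | succ n =>
      have : (n : ℂ) + 1 ≠ 0 := Nat.cast_add_one_ne_zero n
      simp [PowerSeries.coeff_succ_X_mul, PowerSeries.coeff_derivative, F, this]
  have hs := hasSubst_of_constantCoeff hF0
  let f : UnitalSeries := ⟨(PowerSeries.exp ℂ).subst F, by
    have : PowerSeries.constantCoeff ((PowerSeries.exp ℂ - 1).subst F) = 0 :=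
      PowerSeries.constantCoeff_subst_eq_zero hF0 _ (by simp)
    rw [PowerSeries.subst_sub hs, subst_one_eq_one, map_sub, map_one, sub_eq_zero] at this
    exact this⟩
  refine ⟨f, Subtype.ext (mul_left_cancel₀ f.ne_zero ?_)⟩
  rw [mul_zDLog, ← hF]
  simp only [f, PowerSeries.derivative_subst hs, PowerSeries.derivative_exp]
  ring

lemma zDLog_bijective : Function.Bijective zDLog := ⟨zDLog_injective, zDLog_surjective⟩

/-! ### Power series in locally nilpotent operators -/

section LocallyNilpotent

variable {V : Type*} [AddCommGroup V] [Module ℂ V]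

/-- The operator `f(L) = ∑ fₖ Lᵏ`, for a power series `f` and a locally nilpotent operator `L`. -/
def seriesEval (L : Module.End ℂ V) (hL : ∀ v, ∃ N, (L ^ N) v = 0) (f : ℂ⟦X⟧) :
    Module.End ℂ V :=
  have hfin : ∀ v, (Function.support fun k => PowerSeries.coeff k f • (L ^ k) v).Finite := by
    intro v
    obtain ⟨N, hN⟩ := hL v
    refine (Set.finite_lt_nat N).subset fun k hk => ?_
    by_contra hkN
    obtain ⟨d, rfl⟩ := Nat.exists_eq_add_of_le' (not_lt.1 hkN)
    exact hk (by simp [pow_add, hN])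
  { toFun := fun v => ∑ᶠ k, PowerSeries.coeff k f • (L ^ k) v
    map_add' := fun v w => by
      simp only [map_add, smul_add]
      exact finsum_add_distrib (hfin v) (hfin w)
    map_smul' := fun c v => by
      simp only [map_smul, RingHom.id_apply, smul_finsum]
      exact finsum_congr fun k => smul_comm _ _ _ }

lemma seriesEval_apply_of_pow_eq_zero {L : Module.End ℂ V} (hL : ∀ v, ∃ N, (L ^ N) v = 0)
    (f : ℂ⟦X⟧) {v : V} {N : ℕ} (hN : (L ^ N) v = 0) :
    seriesEval L hL f v = ∑ k ∈ Finset.range N, PowerSeries.coeff k f • (L ^ k) v := by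
  refine finsum_eq_sum_of_support_subset _ fun k hk => ?_
  by_contra hkN
  simp only [Finset.coe_range, Set.mem_Iio, not_lt] at hkN
  obtain ⟨d, rfl⟩ := Nat.exists_eq_add_of_le' hkN
  exact hk (by simp [pow_add, hN])

/-- The generating series of a sequence of vectors, tested against a functional. -/
def genSeries (ψ : V →ₗ[ℂ] ℂ) (ω : ℕ → V) : ℂ⟦X⟧ := PowerSeries.mk fun k => ψ (ω k)

lemma genSeries_eq_shift (ψ : V →ₗ[ℂ] ℂ) (ω : ℕ → V) :
    genSeries ψ ω = PowerSeries.C (ψ (ω 0)) + PowerSeries.X * genSeries ψ fun k => ω (k + 1) := by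
  ext k
  cases k with
  | zero => simp [genSeries]
  | succ k => simp [genSeries, PowerSeries.coeff_succ_X_mul]

lemma genSeries_comp (ψ : V →ₗ[ℂ] ℂ) (T : Module.End ℂ V) (ω : ℕ → V) :
    genSeries (ψ ∘ₗ T) ω = genSeries ψ fun k => T (ω k) := rfl

lemma genSeries_add (ψ : V →ₗ[ℂ] ℂ) (ω ω' : ℕ → V) :
    (genSeries ψ fun k => ω k + ω' k) = genSeries ψ ω + genSeries ψ ω' := by
  ext k
  simp [genSeries]

/-- `L` shifts the sequence down, hence multiplies its generating series by z; so f(L) multiplies it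
by f(z). -/
lemma genSeries_seriesEval {L : Module.End ℂ V} (hL : ∀ v, ∃ N, (L ^ N) v = 0) (f : ℂ⟦X⟧)
    (ψ : V →ₗ[ℂ] ℂ) {ω : ℕ → V} (h0 : L (ω 0) = 0) (hs : ∀ k, L (ω (k + 1)) = ω k) :
    (genSeries ψ fun k => seriesEval L hL f (ω k)) = f * genSeries ψ ω := by
  have hpow : ∀ i k, (L ^ i) (ω (k + i)) = ω k := by
    intro i
    induction i with
    | zero => simp
    | succ i ih => intro k; rw [pow_succ, Module.End.mul_apply, ← add_assoc, hs, ih]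
  ext k
  have hk : (L ^ (k + 1)) (ω k) = 0 := by
    have := hpow k 0
    rw [zero_add] at this
    rw [pow_succ', Module.End.mul_apply, this, h0]
  rw [genSeries, PowerSeries.coeff_mk, seriesEval_apply_of_pow_eq_zero hL f hk,
    PowerSeries.coeff_mul, Finset.Nat.sum_antidiagonal_eq_sum_range_succ_mk, map_sum]
  refine Finset.sum_congr rfl fun i hi => ?_
  obtain ⟨d, rfl⟩ := Nat.exists_eq_add_of_le' (Finset.mem_range_succ_iff.1 hi)
  simp [hpow, genSeries]

variable {ε : V →ₗ[ℂ] ℂ} {ω : ℕ → V} {T : Module.End ℂ V} {h w : ℂ⟦X⟧}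

lemma genSeries_eq_one (hε0 : ε (ω 0) = 1) (hε : ∀ k, ε (ω (k + 1)) = 0) :
    genSeries ε ω = 1 := by
  ext k
  cases k with
  | zero => simp [genSeries, hε0]
  | succ k => simp [genSeries, hε, PowerSeries.coeff_one]

/-- The resolvent identity for an operator acting on generating series as `1/z + h(z)`. -/
lemma subst_moments_of_add (hε0 : ε (ω 0) = 1) (hε : ∀ k, ε (ω (k + 1)) = 0)
    (hT : ∀ ψ : V →ₗ[ℂ] ℂ, (genSeries ψ fun k => T (ω k)) =
      (genSeries ψ fun k => ω (k + 1)) + h * genSeries ψ ω)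
    (hw : w * (1 + PowerSeries.X * h) = PowerSeries.X) :
    (PowerSeries.mk fun n => ε ((T ^ n) (ω 0))).subst w = 1 + PowerSeries.X * h := by
  have hw0 : PowerSeries.constantCoeff w = 0 := by
    simpa using congrArg PowerSeries.constantCoeff hw
  -- With ω(z) = ∑ zᵏ ωₖ, the hypothesis reads T ω(z) = ω(z)/w - ω₀/z. Multiplying by z and applying
  -- ε Tⁿ gives the recursion for uₙ = (z/w) ε(Tⁿ ω(z)), where z/w = 1 + zh.
  rw [subst_mk_of_recursion hw0 _
    (fun n => (1 + PowerSeries.X * h) * genSeries (ε ∘ₗ T ^ n) ω)]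
  · rw [pow_zero, Module.End.one_eq_id, LinearMap.comp_id, genSeries_eq_one hε0 hε, mul_one]
  · intro n
    have h1 := hT (ε ∘ₗ T ^ n)
    have h2 := genSeries_eq_shift (ε ∘ₗ T ^ n) ω
    have h3 : genSeries (ε ∘ₗ T ^ (n + 1)) ω = genSeries (ε ∘ₗ T ^ n) fun k => T (ω k) := rfl
    rw [h3, h1]
    rw [LinearMap.comp_apply] at h2
    linear_combination h2 - hw * ((genSeries (ε ∘ₗ T ^ n) fun k => ω (k + 1)) +
      h * genSeries (ε ∘ₗ T ^ n) ω)

/-- The resolvent identity for an operator acting on generating series as `h(z) (1 + 1/z)`. -/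
lemma subst_moments_of_mul (hε0 : ε (ω 0) = 1) (hε : ∀ k, ε (ω (k + 1)) = 0)
    (hT : ∀ ψ : V →ₗ[ℂ] ℂ, (genSeries ψ fun k => T (ω k)) =
      h * (genSeries ψ ω + genSeries ψ fun k => ω (k + 1)))
    (hw0 : PowerSeries.constantCoeff w = 0) (hw : w * ((1 + PowerSeries.X) * h) = PowerSeries.X) :
    (PowerSeries.mk fun n => ε ((T ^ n) (ω 0))).subst w = 1 + PowerSeries.X := by
  -- Here T ω(z) = ω(z)/w - h ω₀/z, which is (1 - wT)(1 + z) ω(z) = ω₀; this dictates the factor 1 +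
  -- z in uₙ.
  rw [subst_mk_of_recursion hw0 _
    (fun n => (1 + PowerSeries.X) * genSeries (ε ∘ₗ T ^ n) ω)]
  · rw [pow_zero, Module.End.one_eq_id, LinearMap.comp_id, genSeries_eq_one hε0 hε, mul_one]
  · intro n
    have h1 := hT (ε ∘ₗ T ^ n)
    have h2 := genSeries_eq_shift (ε ∘ₗ T ^ n) ω
    have h3 : genSeries (ε ∘ₗ T ^ (n + 1)) ω = genSeries (ε ∘ₗ T ^ n) fun k => T (ω k) := rfl
    rw [h3, h1]
    rw [LinearMap.comp_apply] at h2
    linear_combination h2 - hw * ((genSeries (ε ∘ₗ T ^ n) ω) +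
      (genSeries (ε ∘ₗ T ^ n) fun k => ω (k + 1)))


end LocallyNilpotent

/-! ### The algebraic full Fock space -/

/-- The full Fock space with one creation operator for each element of `I`. -/
abbrev Fock (I : Type u) : Type u := List I →₀ ℂ

namespace Fock

variable {I : Type u}

/-- The basis vector of a word. -/
abbrev word (w : List I) : Fock I := Finsupp.single w 1

/-- The creation operator. -/
def creation (i : I) : Module.End ℂ (Fock I) := Finsupp.lmapDomain ℂ ℂ (List.cons i)

/-- Concatenation with a word on the right. -/
def rightConcat (w : List I) : Module.End ℂ (Fock I) := Finsupp.lmapDomain ℂ ℂ (· ++ w)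

@[simp] lemma creation_word (i : I) (w : List I) : creation i (word w) = word (i :: w) := by
  simp [creation]

@[simp] lemma rightConcat_word (v w : List I) :
    rightConcat w (word v) = word (v ++ w) := by
  simp [rightConcat]

lemma ext_word {V : Type*} [AddCommGroup V] [Module ℂ V] {S T : Fock I →ₗ[ℂ] V}
    (h : ∀ w, S (word w) = T (word w)) : S = T := by
  ext w
  simpa using h w

/-- The vacuum state. -/
def vacuum (I : Type u) : NCProbSpace (Module.End ℂ (Fock I)) where
  φ := Finsupp.lapply [] ∘ₗ LinearMap.applyₗ (word [])
  map_one := by simp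

lemma vacuum_apply (T : Module.End ℂ (Fock I)) : (vacuum I).φ T = T (word []) [] := rfl

lemma moment_law_vacuum (T : Module.End ℂ (Fock I)) (n : ℕ) :
    ((vacuum I).law T).moment n = (T ^ n) (word []) [] := by
  simp [Law.moment, NCProbSpace.law, vacuum_apply]

/-! ### Subalgebras attached to letters, and their freeness in the vacuum state -/

/-- The span of the words in the single letter `i`. -/
def ray (i : I) : Submodule ℂ (Fock I) := Submodule.span ℂ (Set.range fun k => word (List.replicate k i))

lemma word_replicate_mem_ray (i : I) (k : ℕ) : word (List.replicate k i) ∈ ray i :=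
  Submodule.subset_span ⟨k, rfl⟩

lemma vacuum_mem_ray (i : I) : word [] ∈ ray i := word_replicate_mem_ray i 0

/-- The operators which act on the leading powers of the letter `i` only. -/
def leading (i : I) : Subalgebra ℂ (Module.End ℂ (Fock I)) where
  carrier := {T | ∀ v ∈ ray i, T v ∈ ray i ∧
    ∀ w : List I, w.head? ≠ some i → T (rightConcat w v) = rightConcat w (T v)}
  mul_mem' := fun {S T} hS hT v hv => by
    obtain ⟨h1, h2⟩ := hT v hv
    obtain ⟨h3, h4⟩ := hS _ h1
    exact ⟨h3, fun w hw => by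
      rw [Module.End.mul_apply, h2 w hw, h4 w hw, Module.End.mul_apply]⟩
  add_mem' := fun {S T} hS hT v hv => by
    obtain ⟨h1, h2⟩ := hT v hv
    obtain ⟨h3, h4⟩ := hS v hv
    exact ⟨add_mem h3 h1, fun w hw => by
      rw [LinearMap.add_apply, h2 w hw, h4 w hw, LinearMap.add_apply, map_add]⟩
  algebraMap_mem' := fun c v hv => by
    refine ⟨?_, fun w _ => ?_⟩
    · simpa [Module.algebraMap_end_apply] using (ray i).smul_mem c hv
    · simp [Module.algebraMap_end_apply]

lemma mem_leading_of_word {i : I} {T : Module.End ℂ (Fock I)}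
    (h1 : ∀ k, T (word (List.replicate k i)) ∈ ray i)
    (h2 : ∀ k, ∀ w : List I, w.head? ≠ some i →
      T (word (List.replicate k i ++ w)) = rightConcat w (T (word (List.replicate k i)))) :
    T ∈ leading i := by
  intro v hv
  induction hv using Submodule.span_induction with
  | mem x hx =>
    obtain ⟨k, rfl⟩ := hx
    exact ⟨h1 k, fun w hw => by simpa using h2 k w hw⟩
  | zero => simp
  | add x y _ _ hx hy =>
    refine ⟨?_, fun w hw => ?_⟩
    · rw [map_add]; exact add_mem hx.1 hy.1
    · simp only [map_add, hx.2 w hw, hy.2 w hw]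
  | smul c x _ hx =>
    refine ⟨?_, fun w hw => ?_⟩
    · rw [map_smul]; exact Submodule.smul_mem _ _ hx.1
    · simp only [map_smul, hx.2 w hw]

lemma creation_mem_leading (i : I) : creation i ∈ leading i := by
  refine mem_leading_of_word (fun k => ?_) fun k w _ => ?_
  · rw [creation_word]
    exact word_replicate_mem_ray i (k + 1)
  · simp

/-- The span of the words starting with the letter `i`. -/
def startingWith (i : I) : Submodule ℂ (Fock I) :=
  Finsupp.supported ℂ ℂ {w : List I | w.head? = some i}

/-- TΩ is a combination of powers of `i`, without vacuum term because `T` is centred; T sends `w` to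
the concatenation of TΩ with `w`. -/
lemma apply_word_mem_startingWith {i : I} {T : Module.End ℂ (Fock I)} (hT : T ∈ leading i)
    (h0 : (vacuum I).φ T = 0) {w : List I} (hw : w.head? ≠ some i) :
    T (word w) ∈ startingWith i := by
  obtain ⟨h1, h2⟩ := hT _ (vacuum_mem_ray i)
  have h3 := h2 w hw
  rw [rightConcat_word, List.nil_append] at h3
  rw [h3]
  have hray : ray i ≤ Finsupp.supported ℂ ℂ (Set.range fun k => List.replicate k i) := by
    refine Submodule.span_le.2 ?_
    rintro _ ⟨k, rfl⟩
    exact Finsupp.single_mem_supported _ _ ⟨k, rfl⟩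
  have h4 : T (word []) ∈ Finsupp.supported ℂ ℂ (Set.range fun k => List.replicate (k + 1) i) := by
    intro v hv
    obtain ⟨k, rfl⟩ := hray h1 hv
    cases k with
    | zero => exact absurd h0 (by simpa [vacuum_apply] using hv)
    | succ k => exact ⟨k, rfl⟩
  have h5 : rightConcat w (T (word [])) ∈ (Finsupp.supported ℂ ℂ
      (Set.range fun k => List.replicate (k + 1) i)).map (Finsupp.lmapDomain ℂ ℂ (· ++ w)) :=
    ⟨_, h4, rfl⟩
  rw [Finsupp.lmapDomain_supported] at h5
  refine Finsupp.supported_mono ?_ h5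
  rintro _ ⟨_, ⟨k, rfl⟩, rfl⟩
  simp [List.replicate_succ]

lemma apply_mem_startingWith {i j : I} (hij : i ≠ j) {T : Module.End ℂ (Fock I)}
    (hT : T ∈ leading i) (h0 : (vacuum I).φ T = 0) {v : Fock I} (hv : v ∈ startingWith j) :
    T v ∈ startingWith i := by
  rw [startingWith, Finsupp.supported_eq_span_single] at hv
  induction hv using Submodule.span_induction with
  | mem x hx =>
    obtain ⟨w, hw, rfl⟩ := hx
    refine apply_word_mem_startingWith hT h0 ?_
    rw [show w.head? = some j from hw]
    simpa using hij.symm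
  | zero => simp
  | add x y _ _ hx hy => rw [map_add]; exact add_mem hx hy
  | smul c x _ hx => rw [map_smul]; exact Submodule.smul_mem _ _ hx

lemma prod_apply_mem_startingWith (n : ℕ) (i : Fin (n + 1) → I)
    (x : Fin (n + 1) → Module.End ℂ (Fock I)) (hi : ∀ j : Fin n, i j.castSucc ≠ i j.succ)
    (hx : ∀ j, x j ∈ leading (i j)) (h0 : ∀ j, (vacuum I).φ (x j) = 0) :
    (List.ofFn x).prod (word []) ∈ startingWith (i 0) := by
  induction n with
  | zero =>
    simpa using apply_word_mem_startingWith (hx 0) (h0 0) (w := []) (by simp)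
  | succ n ih =>
    rw [List.ofFn_succ, List.prod_cons, Module.End.mul_apply]
    exact apply_mem_startingWith (hi 0) (hx 0) (h0 0)
      (ih (fun j => i j.succ) (fun j => x j.succ) (fun j => hi j.succ) (fun j => hx _)
        fun j => h0 _)

/-- Applied from right to left, each centred factor puts its own letter in front, and the next
factor has a different letter. The final vector has no vacuum component. -/
theorem isFree_leading : (vacuum I).IsFree (leading : I → _) := by
  intro n i x hi hx h0
  have h := prod_apply_mem_startingWith n i x hi hx h0
  rw [vacuum_apply]
  by_contra hne
  have := h (Finsupp.mem_support_iff.2 hne)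
  simp at this

lemma isFreePair_of_mem_leading {i j : I} (hij : i ≠ j) {a b : Module.End ℂ (Fock I)}
    (ha : a ∈ leading i) (hb : b ∈ leading j) : (vacuum I).IsFreePair a b := by
  have hinj : Function.Injective (![i, j] : Fin 2 → I) := by
    intro p q
    fin_cases p <;> fin_cases q <;> simp [hij, hij.symm]
  intro n k x hk hx h0
  refine isFree_leading n (fun m => ![i, j] (k m)) x (fun m => hinj.ne (hk m)) (fun m => ?_) h0
  refine Algebra.adjoin_le ?_ (hx m)
  generalize k m = q
  fin_cases q <;> simpa

/-! ### Transforms read off from the orbit of the vacuum -/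

/-- The sequence `Cᵏ Ω`. -/
def orbit (C : Module.End ℂ (Fock I)) (k : ℕ) : Fock I := (C ^ k) (word [])

@[simp] lemma orbit_zero (C : Module.End ℂ (Fock I)) : orbit C 0 = word [] := by simp [orbit]

lemma orbit_succ (C : Module.End ℂ (Fock I)) (k : ℕ) : orbit C (k + 1) = C (orbit C k) := by
  rw [orbit, pow_succ', Module.End.mul_apply, orbit]

lemma creation_apply_nil (i : I) (v : Fock I) : creation i v [] = 0 := by
  have : Finsupp.lapply [] ∘ₗ creation i = (0 : Fock I →ₗ[ℂ] ℂ) := ext_word fun w => by simp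
  exact LinearMap.congr_fun this v

lemma exists_mul_one_add_X_mul (f : ℂ⟦X⟧) :
    ∃ w : ℂ⟦X⟧, w * (1 + PowerSeries.X * f) = PowerSeries.X :=
  ⟨PowerSeries.X * (1 + PowerSeries.X * f)⁻¹, by
    rw [mul_assoc, PowerSeries.inv_mul_cancel _ (by simp), mul_one]⟩

lemma calRTransform_law_of_genSeries {C T : Module.End ℂ (Fock I)} {f : ℂ⟦X⟧}
    (hC : ∀ v, C v [] = 0)
    (hT : ∀ ψ : Fock I →ₗ[ℂ] ℂ, (genSeries ψ fun k => T (orbit C k)) =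
      (genSeries ψ fun k => orbit C (k + 1)) + f * genSeries ψ (orbit C)) :
    calRTransform ((vacuum I).law T) = f := by
  obtain ⟨w, hw⟩ := exists_mul_one_add_X_mul f
  refine calRTransform_eq_of_subst hw ?_
  have hw0 : PowerSeries.constantCoeff w = 0 := by
    simpa using congrArg PowerSeries.constantCoeff hw
  have hs := hasSubst_of_constantCoeff hw0
  have h := subst_moments_of_add (ε := Finsupp.lapply []) (by simp)
    (fun k => by rw [orbit_succ]; exact hC _) hT hw
  simp only [orbit_zero, Finsupp.lapply_apply, ← moment_law_vacuum] at h
  rw [cauchySeries, PowerSeries.subst_mul hs, PowerSeries.subst_X hs, h, hw]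

lemma sTransform_law_of_genSeries {C T : Module.End ℂ (Fock I)} {f : ℂ⟦X⟧}
    (hC : ∀ v, C v [] = 0) (hf : PowerSeries.constantCoeff f = 1)
    (hT : ∀ ψ : Fock I →ₗ[ℂ] ℂ, (genSeries ψ fun k => T (orbit C k)) =
      f * (genSeries ψ (orbit C) + genSeries ψ fun k => orbit C (k + 1))) :
    ∃ h : ((vacuum I).law T).toLin Polynomial.X = 1,
      (sTransform ⟨(vacuum I).law T, h⟩).1 = f⁻¹ := by
  have hunit : ((1 + PowerSeries.X) * f)⁻¹ * ((1 + PowerSeries.X) * f) = 1 :=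
    PowerSeries.inv_mul_cancel _ (by simp [hf])
  have hinv : f * f⁻¹ = 1 := PowerSeries.mul_inv_cancel _ (by simp [hf])
  set w : ℂ⟦X⟧ := PowerSeries.X * ((1 + PowerSeries.X) * f)⁻¹ with hwdef
  have hw : w * ((1 + PowerSeries.X) * f) = PowerSeries.X := by
    rw [hwdef, mul_assoc, hunit, mul_one]
  have hw0 : PowerSeries.constantCoeff w = 0 := by simp [hwdef]
  have hs := hasSubst_of_constantCoeff hw0
  have hε : ∀ k, Finsupp.lapply (R := ℂ) (M := ℂ) [] (orbit C (k + 1)) = 0 :=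
    fun k => by rw [orbit_succ]; exact hC _
  have h1 : ((vacuum I).law T).toLin Polynomial.X = 1 := by
    -- The constant coefficient of the hypothesis gives the mean: f(0) times the vacuum component of
    -- Ω + CΩ, which is 1.
    have h2 := congrArg PowerSeries.constantCoeff (hT (Finsupp.lapply []))
    have h3 : orbit C 1 [] = 0 := hε 0
    rw [← Law.moment_one, moment_law_vacuum]
    simpa [genSeries, hf, h3] using h2
  refine ⟨h1, sSeries_eq_of_subst (by rw [h1]; exact one_ne_zero) (w := w) ?_ ?_⟩
  · linear_combination -f⁻¹ * hw + (1 + PowerSeries.X) * w * hinv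
  · have h := subst_moments_of_mul (ε := Finsupp.lapply []) (by simp) hε hT hw0 hw
    simp only [orbit_zero, Finsupp.lapply_apply, ← moment_law_vacuum] at h
    have h4 := mk_moment_eq ((vacuum I).law T)
    rw [show PowerSeries.mk (fun n => ((vacuum I).law T).moment n) = _ from h4,
      PowerSeries.subst_add hs, subst_one_eq_one] at h
    exact add_left_cancel h

/-! ### Annihilation operators and power series in them -/

variable [DecidableEq I]

/-- The annihilation operator. -/
def annihilation (i : I) : Module.End ℂ (Fock I) :=
  Finsupp.linearCombination ℂ fun w => if w.head? = some i then word w.tail else 0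

lemma annihilation_word (i : I) (w : List I) :
    annihilation i (word w) = if w.head? = some i then word w.tail else 0 := by
  simp [annihilation]

@[simp] lemma annihilation_vacuum (i : I) : annihilation i (word []) = 0 := by
  simp [annihilation_word]

lemma annihilation_creation_self (i : I) (v : Fock I) : annihilation i (creation i v) = v := by
  have : annihilation i ∘ₗ creation i = LinearMap.id := ext_word fun w => by
    simp [annihilation_word]
  exact LinearMap.congr_fun this v

lemma annihilation_creation_of_ne {i j : I} (h : j ≠ i) (v : Fock I) :
    annihilation i (creation j v) = 0 := by
  have : annihilation i ∘ₗ creation j = 0 := ext_word fun w => by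
    simp [annihilation_word, h]
  exact LinearMap.congr_fun this v

lemma annihilation_mem_leading (i : I) : annihilation i ∈ leading i := by
  refine mem_leading_of_word (fun k => ?_) fun k w hw => ?_
  · cases k with
    | zero => simp
    | succ k => simpa [annihilation_word, List.replicate_succ] using word_replicate_mem_ray i k
  · cases k with
    | zero => simp [annihilation_word, hw]
    | succ k => simp [annihilation_word, List.replicate_succ]

lemma annihilation_locally_nilpotent (i : I) (v : Fock I) :
    ∃ N, (annihilation i ^ N) v = 0 := by
  have hword : ∀ w : List I, (annihilation i ^ (w.length + 1)) (word w) = 0 := by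
    intro w
    induction w with
    | nil => simp
    | cons j w ih =>
      rw [List.length_cons, pow_succ, Module.End.mul_apply, annihilation_word]
      split_ifs
      · exact ih
      · simp
  induction v using Finsupp.induction_linear with
  | zero => exact ⟨0, by simp⟩
  | add v w hv hw =>
    obtain ⟨N, hN⟩ := hv
    obtain ⟨M, hM⟩ := hw
    refine ⟨N + M, ?_⟩
    have h1 : (annihilation i ^ (N + M)) v = 0 := by
      rw [add_comm, pow_add, Module.End.mul_apply, hN, map_zero]
    rw [map_add, h1, pow_add, Module.End.mul_apply, hM, map_zero, add_zero]
  | single w c =>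
    refine ⟨w.length + 1, ?_⟩
    rw [← mul_one c, ← smul_eq_mul, ← Finsupp.smul_single, map_smul, hword, smul_zero]

/-- The operator `f(lᵢ*)`. -/
def annihilationSeries (i : I) (f : ℂ⟦X⟧) : Module.End ℂ (Fock I) :=
  seriesEval (annihilation i) (annihilation_locally_nilpotent i) f

lemma annihilationSeries_mem_leading (i : I) (f : ℂ⟦X⟧) :
    annihilationSeries i f ∈ leading i := by
  -- On any two vectors the series agrees with a single polynomial in the annihilation operator. Two
  -- are needed because commutation with `rightConcat w` compares values at `v` and at `rightConcat
  -- w v`.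
  have key : ∀ v v' : Fock I, ∃ S ∈ leading i, annihilationSeries i f v = S v ∧
      annihilationSeries i f v' = S v' := by
    intro v v'
    obtain ⟨N, hN⟩ := annihilation_locally_nilpotent i v
    obtain ⟨M, hM⟩ := annihilation_locally_nilpotent i v'
    refine ⟨∑ k ∈ Finset.range (N + M), PowerSeries.coeff k f • annihilation i ^ k,
      sum_mem fun k _ => Subalgebra.smul_mem _ (pow_mem (annihilation_mem_leading i) k) _, ?_, ?_⟩
    · rw [annihilationSeries, seriesEval_apply_of_pow_eq_zero (N := N + M)]
      · simp [LinearMap.sum_apply]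
      · rw [add_comm, pow_add, Module.End.mul_apply, hN, map_zero]
    · rw [annihilationSeries, seriesEval_apply_of_pow_eq_zero (N := N + M)]
      · simp [LinearMap.sum_apply]
      · rw [pow_add, Module.End.mul_apply, hM, map_zero]
  intro v hv
  refine ⟨?_, fun w hw => ?_⟩
  · obtain ⟨S, hS, h1, -⟩ := key v v
    rw [h1]
    exact (hS v hv).1
  · obtain ⟨S, hS, h1, h2⟩ := key v (rightConcat w v)
    rw [h1, h2]
    exact (hS v hv).2 w hw

/-! ### Operators with prescribed transforms -/

lemma genSeries_annihilationSeries (i : I) (f : ℂ⟦X⟧) (ψ : Fock I →ₗ[ℂ] ℂ) {ω : ℕ → Fock I}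
    (h0 : annihilation i (ω 0) = 0) (hs : ∀ k, annihilation i (ω (k + 1)) = ω k) :
    (genSeries ψ fun k => annihilationSeries i f (ω k)) = f * genSeries ψ ω :=
  genSeries_seriesEval _ f ψ h0 hs

/-- A creation operator perturbed additively: its `R`-transform is `z f(z)`. -/
def addModel (i : I) (f : ℂ⟦X⟧) : Module.End ℂ (Fock I) := creation i + annihilationSeries i f

/-- A creation operator perturbed multiplicatively: its `S`-transform is `1 / f(z)`. -/
def mulModel (i : I) (f : ℂ⟦X⟧) : Module.End ℂ (Fock I) :=
  (1 + creation i) * annihilationSeries i f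

lemma addModel_mem_leading (i : I) (f : ℂ⟦X⟧) : addModel i f ∈ leading i :=
  add_mem (creation_mem_leading i) (annihilationSeries_mem_leading i f)

lemma mulModel_mem_leading (i : I) (f : ℂ⟦X⟧) : mulModel i f ∈ leading i :=
  mul_mem (add_mem (one_mem _) (creation_mem_leading i)) (annihilationSeries_mem_leading i f)

lemma calRTransform_law_addModel (i : I) (f : ℂ⟦X⟧) :
    calRTransform ((vacuum I).law (addModel i f)) = f := by
  refine calRTransform_law_of_genSeries (C := creation i) (creation_apply_nil i) fun ψ => ?_
  rw [← genSeries_annihilationSeries i f ψ (by simp)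
    (fun k => by rw [orbit_succ, annihilation_creation_self]), ← genSeries_add]
  simp only [addModel, orbit_succ, LinearMap.add_apply]

/-- Both annihilation operators are left inverses of C = lᵢ + lⱼ, so both shift the same orbit down.
-/
lemma calRTransform_law_addModel_add {i j : I} (hij : i ≠ j) (f g : ℂ⟦X⟧) :
    calRTransform ((vacuum I).law (addModel i f + addModel j g)) = f + g := by
  refine calRTransform_law_of_genSeries (C := creation i + creation j)
    (fun v => by simp [creation_apply_nil]) fun ψ => ?_
  rw [add_mul, ← genSeries_annihilationSeries i f ψ (by simp)
    (fun k => by rw [orbit_succ, LinearMap.add_apply, map_add, annihilation_creation_self,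
      annihilation_creation_of_ne hij.symm, add_zero]),
    ← genSeries_annihilationSeries j g ψ (by simp)
    (fun k => by rw [orbit_succ, LinearMap.add_apply, map_add, annihilation_creation_self,
      annihilation_creation_of_ne hij, zero_add]), ← genSeries_add, ← genSeries_add]
  simp only [addModel, orbit_succ, LinearMap.add_apply]
  congr 1
  ext1 k
  abel

lemma genSeries_mulModel (i : I) (f : ℂ⟦X⟧) (ψ : Fock I →ₗ[ℂ] ℂ) {ω : ℕ → Fock I}
    (h0 : annihilation i (ω 0) = 0) (hs : ∀ k, annihilation i (ω (k + 1)) = ω k) :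
    (genSeries ψ fun k => mulModel i f (ω k)) =
      f * genSeries ψ fun k => ω k + creation i (ω k) := by
  have h := genSeries_annihilationSeries i f (ψ ∘ₗ (1 + creation i)) h0 hs
  rw [genSeries_comp, genSeries_comp] at h
  exact h

lemma sTransform_law_mulModel (i : I) {f : ℂ⟦X⟧} (hf : PowerSeries.constantCoeff f = 1) :
    ∃ h : ((vacuum I).law (mulModel i f)).toLin Polynomial.X = 1,
      (sTransform ⟨(vacuum I).law (mulModel i f), h⟩).1 = f⁻¹ := by
  refine sTransform_law_of_genSeries (C := creation i) (creation_apply_nil i) hf fun ψ => ?_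
  rw [← genSeries_add, genSeries_mulModel i f ψ (by simp)
    (fun k => by rw [orbit_succ, annihilation_creation_self])]
  simp only [orbit_succ]

lemma sTransform_law_mulModel_mul {i j : I} (hij : i ≠ j) {f g : ℂ⟦X⟧}
    (hf : PowerSeries.constantCoeff f = 1) (hg : PowerSeries.constantCoeff g = 1) :
    ∃ h : ((vacuum I).law (mulModel i f * mulModel j g)).toLin Polynomial.X = 1,
      (sTransform ⟨(vacuum I).law (mulModel i f * mulModel j g), h⟩).1 = (f * g)⁻¹ := by
  -- C is chosen so that 1 + C = (1 + lᵢ)(1 + lⱼ). Then lⱼ* shifts the orbit CᵏΩ down, while lᵢ*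
  -- shifts the sequence (1 + lⱼ)CᵏΩ that the right factor produces.
  obtain ⟨C, hC⟩ : ∃ C : Module.End ℂ (Fock I),
      ∀ v, C v = creation i (v + creation j v) + creation j v :=
    ⟨creation i * (1 + creation j) + creation j, fun v => by simp⟩
  refine sTransform_law_of_genSeries (C := C) (fun v => by simp [hC, creation_apply_nil])
    (by simp [hf, hg]) fun ψ => ?_
  have h1 := genSeries_mulModel j g (ψ ∘ₗ mulModel i f) (ω := orbit C) (by simp)
    fun k => by
      rw [orbit_succ, hC, map_add, annihilation_creation_of_ne hij,
        annihilation_creation_self, zero_add]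
  have h2 := genSeries_mulModel i f ψ (ω := fun k => orbit C k + creation j (orbit C k))
    (by simp [annihilation_word, hij.symm]) fun k => by
      rw [orbit_succ, hC, map_add, map_add, annihilation_creation_self, map_add (creation j),
        map_add, annihilation_creation_of_ne hij.symm, annihilation_creation_of_ne hij.symm,
        annihilation_creation_of_ne hij.symm, add_zero, add_zero, add_zero]
  have h3 : ∀ k, orbit C k + creation j (orbit C k) +
      creation i (orbit C k + creation j (orbit C k)) = orbit C k + orbit C (k + 1) := by
    intro k
    rw [orbit_succ, hC]
    abel
  simp only [h3, genSeries_add] at h2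
  rw [genSeries_comp, genSeries_comp] at h1
  rw [mul_comm f g, mul_assoc, ← h2, ← h1]
  simp only [Module.End.mul_apply]

end Fock

/-! ### The joint distribution of free random variables -/

section JointLaw

variable {I : Type*}

/-- The product of polynomials in the free generators. -/
def freeWord (l : List (I × ℂ[X])) : FreeAlgebra ℂ I :=
  (l.map fun p => Polynomial.aeval (FreeAlgebra.ι ℂ p.1) p.2).prod

lemma freeWord_cons (i : I) (p : ℂ[X]) (l : List (I × ℂ[X])) :
    freeWord ((i, p) :: l) = Polynomial.aeval (FreeAlgebra.ι ℂ i) p * freeWord l := by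
  simp [freeWord]

/-- Consecutive factors involve distinct generators. -/
abbrev IsAlternating (l : List (I × ℂ[X])) : Prop := l.IsChain fun p q => p.1 ≠ q.1

/-- The span of the alternating products of centred polynomials in the generators. -/
def centredSpan (μ : I → Law) : Submodule ℂ (FreeAlgebra ℂ I) :=
  Submodule.span ℂ (freeWord '' {l | IsAlternating l ∧ ∀ p ∈ l, (μ p.1).toLin p.2 = 0})

/-- Subtracting its mean from `q` makes the first factor centred; the constant left over contributes
a multiple of the shorter word. -/
lemma aeval_mul_freeWord_mem {μ : I → Law} {i : I} (q : ℂ[X]) {l : List (I × ℂ[X])}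
    (hl : IsAlternating ((i, q) :: l)) (hc : ∀ p ∈ l, (μ p.1).toLin p.2 = 0) :
    Polynomial.aeval (FreeAlgebra.ι ℂ i) q * freeWord l ∈ centredSpan μ := by
  set c := (μ i).toLin q with hcdef
  have hq : Polynomial.aeval (FreeAlgebra.ι ℂ i) q * freeWord l =
      freeWord ((i, q - c • 1) :: l) + c • freeWord l := by
    rw [freeWord_cons, map_sub, map_smul, map_one, sub_mul, smul_mul_assoc, one_mul,
      sub_add_cancel]
  rw [hq]
  refine add_mem (Submodule.subset_span ⟨_, ⟨?_, ?_⟩, rfl⟩)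
    (Submodule.smul_mem _ _ (Submodule.subset_span ⟨_, ⟨hl.tail, hc⟩, rfl⟩))
  · exact hl.imp_head (x := (i, q)) (y := (i, q - c • 1)) fun h => h
  · intro p hp
    rcases List.mem_cons.1 hp with rfl | hp
    · simp [(μ i).map_one, hcdef]
    · exact hc p hp

/-- The generator is the polynomial X in itself: it is absorbed by the first factor if the letters
agree, and otherwise becomes a new first factor. -/
lemma ι_mul_freeWord_mem {μ : I → Law} (i : I) {l : List (I × ℂ[X])} (hl : IsAlternating l)
    (hc : ∀ p ∈ l, (μ p.1).toLin p.2 = 0) :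
    FreeAlgebra.ι ℂ i * freeWord l ∈ centredSpan μ := by
  have hX : Polynomial.aeval (FreeAlgebra.ι ℂ i) (Polynomial.X : ℂ[X]) = FreeAlgebra.ι ℂ i :=
    Polynomial.aeval_X _
  cases l with
  | nil =>
    rw [← hX]
    exact aeval_mul_freeWord_mem _ (List.IsChain.singleton _) hc
  | cons p l =>
    obtain ⟨j, p⟩ := p
    by_cases hij : i = j
    · subst hij
      rw [freeWord_cons, ← mul_assoc]
      nth_rewrite 1 [← hX]
      rw [← map_mul]
      have hl' : IsAlternating ((i, Polynomial.X * p) :: l) :=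
        hl.imp_head (x := (i, p)) (y := (i, Polynomial.X * p)) fun h => h
      exact aeval_mul_freeWord_mem _ hl'
        fun q hq => hc q (List.mem_cons_of_mem _ hq)
    · rw [← hX]
      exact aeval_mul_freeWord_mem _ (List.isChain_cons_cons.2 ⟨hij, hl⟩) hc

/-- The span is a left ideal containing 1, the empty word. Freeness fixes the state on its spanning
words, hence everywhere. -/
theorem centredSpan_eq_top (μ : I → Law) : centredSpan μ = ⊤ := by
  have key : ∀ x : FreeAlgebra ℂ I, ∀ y ∈ centredSpan μ, x * y ∈ centredSpan μ := by
    intro x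
    induction x using FreeAlgebra.induction with
    | grade0 c =>
      intro y hy
      rw [← Algebra.smul_def]
      exact Submodule.smul_mem _ _ hy
    | grade1 i =>
      intro y hy
      induction hy using Submodule.span_induction with
      | mem y hy =>
        obtain ⟨l, ⟨hl, hc⟩, rfl⟩ := hy
        exact ι_mul_freeWord_mem i hl hc
      | zero => simp
      | add y z _ _ hy hz => rw [mul_add]; exact add_mem hy hz
      | smul c y _ hy => rw [mul_smul_comm]; exact Submodule.smul_mem _ _ hy
    | mul x z hx hz =>
      intro y hy
      rw [mul_assoc]
      exact hx _ (hz _ hy)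
    | add x z hx hz =>
      intro y hy
      rw [add_mul]
      exact add_mem (hx _ hy) (hz _ hy)
  refine eq_top_iff.2 fun x _ => ?_
  rw [← mul_one x]
  exact key x 1 (Submodule.subset_span ⟨[], ⟨List.IsChain.nil, by simp⟩, by simp [freeWord]⟩)

lemma NCProbSpace.IsFree.map_freeWord {A : Type*} [Ring A] [Algebra ℂ A] {P : NCProbSpace A}
    {a : I → A} (h : P.IsFree fun i => Algebra.adjoin ℂ {a i}) {l : List (I × ℂ[X])}
    (hl : IsAlternating l) (hc : ∀ p ∈ l, (P.law (a p.1)).toLin p.2 = 0) :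
    P.φ (FreeAlgebra.lift ℂ a (freeWord l)) = if l = [] then 1 else 0 := by
  cases l with
  | nil => simp [freeWord, P.map_one]
  | cons p l =>
    obtain ⟨n, f, hf⟩ : ∃ n, ∃ f : Fin (n + 1) → I × ℂ[X], p :: l = List.ofFn f :=
      ⟨l.length, (p :: l).get, (List.ofFn_get (p :: l)).symm⟩
    rw [if_neg (List.cons_ne_nil _ _)]
    rw [hf] at hl hc ⊢
    rw [freeWord, map_list_prod, List.map_map, List.map_ofFn]
    refine h n (fun j => (f j).1) _ (fun j => ?_) (fun j => ?_) fun j => ?_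
    · exact List.isChain_ofFn.1 hl j.1 (by omega)
    · simp only [Function.comp_apply, ← Polynomial.aeval_algHom_apply, FreeAlgebra.lift_ι_apply]
      exact Polynomial.aeval_mem_adjoin_singleton _ _
    · simp only [Function.comp_apply, ← Polynomial.aeval_algHom_apply, FreeAlgebra.lift_ι_apply]
      exact hc (f j) ((List.mem_ofFn' _ _).2 ⟨j, rfl⟩)

/-- The joint distribution of free random variables is determined by their laws. -/
theorem NCProbSpace.IsFree.joint_law_eq {A A' : Type*} [Ring A] [Algebra ℂ A] [Ring A']
    [Algebra ℂ A'] {P : NCProbSpace A} {P' : NCProbSpace A'} {a : I → A} {a' : I → A'}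
    (h : P.IsFree fun i => Algebra.adjoin ℂ {a i})
    (h' : P'.IsFree fun i => Algebra.adjoin ℂ {a' i})
    (hlaw : ∀ i, P.law (a i) = P'.law (a' i)) (x : FreeAlgebra ℂ I) :
    P.φ (FreeAlgebra.lift ℂ a x) = P'.φ (FreeAlgebra.lift ℂ a' x) := by
  have hx : x ∈ centredSpan fun i => P.law (a i) := by
    rw [centredSpan_eq_top]
    trivial
  induction hx using Submodule.span_induction with
  | mem y hy =>
    obtain ⟨l, ⟨hl, hc⟩, rfl⟩ := hy
    rw [h.map_freeWord hl hc, h'.map_freeWord hl fun p hp => by rw [← hlaw]; exact hc p hp]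
  | zero => simp
  | add y z _ _ hy hz => simp only [map_add, hy, hz]
  | smul c y _ hy => simp only [map_smul, hy]

lemma NCProbSpace.IsFree.law_lift_eq {A A' : Type*} [Ring A] [Algebra ℂ A] [Ring A']
    [Algebra ℂ A'] {P : NCProbSpace A} {P' : NCProbSpace A'} {a : I → A} {a' : I → A'}
    (h : P.IsFree fun i => Algebra.adjoin ℂ {a i})
    (h' : P'.IsFree fun i => Algebra.adjoin ℂ {a' i})
    (hlaw : ∀ i, P.law (a i) = P'.law (a' i)) (x : FreeAlgebra ℂ I) :
    P.law (FreeAlgebra.lift ℂ a x) = P'.law (FreeAlgebra.lift ℂ a' x) := by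
  refine Law.ext_moment fun n => ?_
  simpa [Law.moment, NCProbSpace.law] using h.joint_law_eq h' hlaw (x ^ n)

end JointLaw

/-! ### Free convolutions are well defined -/

universe v

lemma IsFreeAddConv.unique {μ ν ρ ρ' : Law} (h : IsFreeAddConv.{u} μ ν ρ)
    (h' : IsFreeAddConv.{v} μ ν ρ') : ρ = ρ' := by
  obtain ⟨A, _, _, P, a, b, hf, rfl, rfl, rfl⟩ := h
  obtain ⟨A', _, _, P', a', b', hf', ha, hb, rfl⟩ := h'
  have h := NCProbSpace.IsFree.law_lift_eq (a := ![a, b]) (a' := ![a', b']) hf hf'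
    (Fin.forall_fin_two.2 ⟨ha.symm, hb.symm⟩) (FreeAlgebra.ι ℂ 0 + FreeAlgebra.ι ℂ 1)
  rw [map_add, map_add] at h
  simp only [FreeAlgebra.lift_ι_apply] at h
  exact h

lemma IsFreeMulConv.unique {μ ν ρ ρ' : Law} (h : IsFreeMulConv.{u} μ ν ρ)
    (h' : IsFreeMulConv.{v} μ ν ρ') : ρ = ρ' := by
  obtain ⟨A, _, _, P, a, b, hf, rfl, rfl, rfl⟩ := h
  obtain ⟨A', _, _, P', a', b', hf', ha, hb, rfl⟩ := h'
  have h := NCProbSpace.IsFree.law_lift_eq (a := ![a, b]) (a' := ![a', b']) hf hf'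
    (Fin.forall_fin_two.2 ⟨ha.symm, hb.symm⟩) (FreeAlgebra.ι ℂ 0 * FreeAlgebra.ι ℂ 1)
  rw [map_mul, map_mul] at h
  simp only [FreeAlgebra.lift_ι_apply] at h
  exact h

lemma inv_inv_of_constantCoeff_ne_zero {f : ℂ⟦X⟧} (hf : PowerSeries.constantCoeff f ≠ 0) :
    f⁻¹⁻¹ = f :=
  (PowerSeries.inv_eq_iff_mul_eq_one (by simpa using hf)).2 (PowerSeries.mul_inv_cancel f hf)

open Fock in
lemma law_addModel_calRTransform {I : Type u} [DecidableEq I] (i : I) (μ : Law) :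
    (vacuum I).law (addModel i (calRTransform μ)) = μ :=
  calRTransform_injective (calRTransform_law_addModel i _)

open Fock in
lemma exists_isFreeAddConv (μ ν : Law) : ∃ ρ, IsFreeAddConv.{u} μ ν ρ ∧
    calRTransform ρ = calRTransform μ + calRTransform ν := by
  have hne : (ULift.up 0 : ULift.{u} (Fin 2)) ≠ ULift.up 1 := by simp
  exact ⟨_, ⟨_, _, _, vacuum (ULift.{u} (Fin 2)), addModel (ULift.up 0) (calRTransform μ),
    addModel (ULift.up 1) (calRTransform ν),
    isFreePair_of_mem_leading hne (addModel_mem_leading _ _) (addModel_mem_leading _ _),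
    law_addModel_calRTransform _ μ, law_addModel_calRTransform _ ν, rfl⟩,
    calRTransform_law_addModel_add hne _ _⟩

open Fock in
-- The additive models are used even for the product: they realise every law, whereas the
-- multiplicative ones reach only mean one.
lemma exists_isFreeMulConv (μ ν : Law) : ∃ ρ, IsFreeMulConv.{u} μ ν ρ := by
  have hne : (ULift.up 0 : ULift.{u} (Fin 2)) ≠ ULift.up 1 := by simp
  exact ⟨_, _, _, _, vacuum (ULift.{u} (Fin 2)), addModel (ULift.up 0) (calRTransform μ),
    addModel (ULift.up 1) (calRTransform ν),
    isFreePair_of_mem_leading hne (addModel_mem_leading _ _) (addModel_mem_leading _ _),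
    law_addModel_calRTransform _ μ, law_addModel_calRTransform _ ν, rfl⟩

open Fock in
lemma coe_eq_law_mulModel {I : Type u} [DecidableEq I] (i : I) (μ : MeanOneLaw) :
    (vacuum I).law (mulModel i (sTransform μ).1⁻¹) = μ.1 := by
  obtain ⟨h, hs⟩ := sTransform_law_mulModel i (f := (sTransform μ).1⁻¹)
    (by simp [(sTransform μ).2])
  rw [inv_inv_of_constantCoeff_ne_zero (by simp [(sTransform μ).2])] at hs
  exact congrArg Subtype.val (sTransform_injective (Subtype.ext hs))

open Fock in
lemma exists_isFreeMulConv_of_meanOne (μ ν : MeanOneLaw) :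
    ∃ ρ : MeanOneLaw, IsFreeMulConv.{0} μ ν ρ ∧
      sTransform ρ = (sTransform μ).mul (sTransform ν) := by
  have hne : (0 : Fin 2) ≠ 1 := by simp
  have hμ : PowerSeries.constantCoeff (sTransform μ).1 ≠ 0 := by simp [(sTransform μ).2]
  have hν : PowerSeries.constantCoeff (sTransform ν).1 ≠ 0 := by simp [(sTransform ν).2]
  obtain ⟨h, hs⟩ := sTransform_law_mulModel_mul hne (f := (sTransform μ).1⁻¹)
    (g := (sTransform ν).1⁻¹) (by simp [(sTransform μ).2]) (by simp [(sTransform ν).2])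
  refine ⟨⟨_, h⟩, ⟨_, _, _, vacuum (Fin 2), mulModel 0 (sTransform μ).1⁻¹,
    mulModel 1 (sTransform ν).1⁻¹,
    isFreePair_of_mem_leading hne (mulModel_mem_leading _ _) (mulModel_mem_leading _ _),
    coe_eq_law_mulModel _ μ, coe_eq_law_mulModel _ ν, rfl⟩, Subtype.ext ?_⟩
  rw [hs, PowerSeries.mul_inv_rev, inv_inv_of_constantCoeff_ne_zero hμ, inv_inv_of_constantCoeff_ne_zero hν, mul_comm]
  rfl

theorem isFreeAddConv_iff (μ ν ρ : Law) : IsFreeAddConv.{u} μ ν ρ ↔ ρ = freeAddConv μ ν := by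
  obtain ⟨ρ₀, h₀, -⟩ := exists_isFreeAddConv.{0} μ ν
  -- `freeAddConv` is chosen among spaces in universe 0; uniqueness across universes carries it to
  -- `u`.
  have hε : IsFreeAddConv.{0} μ ν (freeAddConv μ ν) := Classical.epsilon_spec ⟨ρ₀, h₀⟩
  obtain ⟨ρ₁, h₁, -⟩ := exists_isFreeAddConv.{u} μ ν
  refine ⟨fun h => h.unique hε, ?_⟩
  rintro rfl
  rwa [← h₁.unique hε]

theorem isFreeMulConv_iff (μ ν ρ : Law) : IsFreeMulConv.{u} μ ν ρ ↔ ρ = freeMulConv μ ν := by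
  obtain ⟨ρ₀, h₀⟩ := exists_isFreeMulConv.{0} μ ν
  have hε : IsFreeMulConv.{0} μ ν (freeMulConv μ ν) := Classical.epsilon_spec ⟨ρ₀, h₀⟩
  obtain ⟨ρ₁, h₁⟩ := exists_isFreeMulConv.{u} μ ν
  refine ⟨fun h => h.unique hε, ?_⟩
  rintro rfl
  rwa [← h₁.unique hε]

/-! ### Bijectivity of the transforms and the group structures -/

lemma coe_rTransform (μ : Law) : (rTransform μ).1 = PowerSeries.X * calRTransform μ := rfl

theorem rTransform_bijective : Function.Bijective rTransform := by
  refine ⟨fun μ ν h => calRTransform_injective ?_, fun h => ?_⟩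
  · exact mul_left_cancel₀ (PowerSeries.X_ne_zero (R := ℂ)) (congrArg Subtype.val h)
  · obtain ⟨f, hf⟩ := PowerSeries.X_dvd_iff.2 h.2
    refine ⟨(Fock.vacuum Unit).law (Fock.addModel () f), Subtype.ext ?_⟩
    rw [hf, coe_rTransform, Fock.calRTransform_law_addModel]

theorem sTransform_bijective : Function.Bijective sTransform := by
  refine ⟨sTransform_injective, fun s => ?_⟩
  obtain ⟨h, hs⟩ := Fock.sTransform_law_mulModel () (f := s.1⁻¹) (by simp [s.2])
  exact ⟨_, Subtype.ext (hs.trans (inv_inv_of_constantCoeff_ne_zero (by simp [s.2])))⟩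

/-- `z ℂ⟦z⟧` as an additive group. -/
instance : AddCommGroup MaxSeries :=
  inferInstanceAs (AddCommGroup (PowerSeries.constantCoeff (R := ℂ)).toAddMonoidHom.ker)

lemma MaxSeries.coe_add (f g : MaxSeries) : (f + g).1 = f.1 + g.1 := rfl

lemma rTransform_freeAddConv (μ ν : Law) :
    rTransform (freeAddConv μ ν) = rTransform μ + rTransform ν := by
  obtain ⟨ρ, h, hρ⟩ := exists_isFreeAddConv.{0} μ ν
  rw [← (isFreeAddConv_iff μ ν ρ).1 h]
  apply Subtype.ext
  simp only [MaxSeries.coe_add, coe_rTransform, hρ, mul_add]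

/-- The additive group of laws, transported by the `R`-transform. -/
abbrev Law.addCommGroup : AddCommGroup Law :=
  (Equiv.ofBijective _ rTransform_bijective).addCommGroup

/-- The multiplicative group of laws of mean one, transported by `(z d/dz log) ∘ S`. -/
abbrev MeanOneLaw.commGroup : CommGroup MeanOneLaw :=
  ((Equiv.ofBijective _ (zDLog_bijective.comp sTransform_bijective)).trans
    Multiplicative.ofAdd).commGroup

lemma Law.coe_addCommGroup_add (μ ν : Law) :
    let _ := Law.addCommGroup
    μ + ν = freeAddConv μ ν := by
  apply rTransform_bijective.1
  rw [rTransform_freeAddConv]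
  exact (Equiv.ofBijective _ rTransform_bijective).apply_symm_apply _

lemma MeanOneLaw.zDLog_sTransform_mul (μ ν : MeanOneLaw) :
    let _ := MeanOneLaw.commGroup
    zDLog (sTransform (μ * ν)) = zDLog (sTransform μ) + zDLog (sTransform ν) :=
  (Equiv.ofBijective _ (zDLog_bijective.comp sTransform_bijective)).apply_symm_apply _

lemma MeanOneLaw.coe_commGroup_mul (μ ν : MeanOneLaw) :
    let _ := MeanOneLaw.commGroup
    ((μ * ν : MeanOneLaw) : Law) = freeMulConv μ ν := by
  obtain ⟨ρ, h, hρ⟩ := exists_isFreeMulConv_of_meanOne μ ν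
  rw [← (isFreeMulConv_iff _ _ _).1 h]
  -- The product was transported along `zDLog ∘ sTransform`; it agrees with ⊠ because both have the
  -- same image under this injective map.
  refine congrArg Subtype.val ((zDLog_bijective.comp sTransform_bijective).1 ?_)
  refine (MeanOneLaw.zDLog_sTransform_mul μ ν).trans (Subtype.ext ?_)
  rw [Function.comp_apply, hρ, zDLog_mul, MaxSeries.coe_add]

lemma rTransform_LOG (μ : MeanOneLaw) : rTransform (LOG μ) = zDLog (sTransform μ) :=
  Function.rightInverse_invFun rTransform_bijective.2 _

lemma zDLog_sTransform_EXP (ν : Law) : zDLog (sTransform (EXP ν)) = rTransform ν := by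
  rw [EXP, Function.comp_apply, Function.rightInverse_invFun sTransform_bijective.2]
  exact Function.rightInverse_invFun zDLog_bijective.2 _

lemma LOG_EXP (ν : Law) : LOG (EXP ν) = ν :=
  rTransform_bijective.1 ((rTransform_LOG _).trans (zDLog_sTransform_EXP ν))

lemma EXP_LOG (μ : MeanOneLaw) : EXP (LOG μ) = μ :=
  (zDLog_bijective.comp sTransform_bijective).1
    ((zDLog_sTransform_EXP _).trans (rTransform_LOG μ))

end FreeProb
end

theorem mainTheorem2 :
    -- the free convolutions are well defined: the law of a sum (product) of a free pair with
    -- prescribed laws exists and depends only on these laws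
    (∀ μ ν ρ : FreeProb.Law,
      FreeProb.IsFreeAddConv.{u} μ ν ρ ↔ ρ = FreeProb.freeAddConv μ ν) ∧
    (∀ μ ν ρ : FreeProb.Law,
      FreeProb.IsFreeMulConv.{u} μ ν ρ ↔ ρ = FreeProb.freeMulConv μ ν) ∧
    -- the three maps that `LOG` and `EXP` are composed of are bijections
    Function.Bijective FreeProb.rTransform ∧
    Function.Bijective FreeProb.sTransform ∧
    Function.Bijective FreeProb.zDLog ∧
    -- `(Σ₁ˣ, ⊠)` and `(Σ, ⊞)` are abelian groups, and `LOG` is an isomorphism with inverse `EXP`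
    ∃ (_ : CommGroup FreeProb.MeanOneLaw) (_ : AddCommGroup FreeProb.Law),
      (∀ μ ν : FreeProb.MeanOneLaw,
        ((μ * ν : FreeProb.MeanOneLaw) : FreeProb.Law) = FreeProb.freeMulConv μ ν) ∧
      (∀ μ ν : FreeProb.Law, μ + ν = FreeProb.freeAddConv μ ν) ∧
      ∃ e : Additive FreeProb.MeanOneLaw ≃+ FreeProb.Law,
        (∀ μ : FreeProb.MeanOneLaw, e (Additive.ofMul μ) = FreeProb.LOG μ) ∧
        (∀ ν : FreeProb.Law, e.symm ν = Additive.ofMul (FreeProb.EXP ν)) := by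
  refine ⟨FreeProb.isFreeAddConv_iff, FreeProb.isFreeMulConv_iff, FreeProb.rTransform_bijective,
    FreeProb.sTransform_bijective, FreeProb.zDLog_bijective, ?_⟩
  let _ := FreeProb.MeanOneLaw.commGroup
  let _ := FreeProb.Law.addCommGroup
  refine ⟨inferInstance, inferInstance, FreeProb.MeanOneLaw.coe_commGroup_mul,
    FreeProb.Law.coe_addCommGroup_add,
    { toFun := fun μ => FreeProb.LOG μ.toMul
      invFun := fun ν => Additive.ofMul (FreeProb.EXP ν)
      left_inv := fun μ => FreeProb.EXP_LOG μ.toMul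
      right_inv := FreeProb.LOG_EXP
      map_add' := fun μ ν => ?_ }, fun _ => rfl, fun _ => rfl⟩
  -- Additivity is checked after applying `rTransform`, where `LOG` becomes `zDLog ∘ sTransform`.
  apply FreeProb.rTransform_bijective.1
  rw [FreeProb.Law.coe_addCommGroup_add, FreeProb.rTransform_freeAddConv,
    FreeProb.rTransform_LOG, FreeProb.rTransform_LOG, FreeProb.rTransform_LOG]
  exact FreeProb.MeanOneLaw.zDLog_sTransform_mul μ.toMul ν.toMul
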